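/- Let $q$ be a power of $2$, let $m$ be an even positive integer, let $\mathrm{Tr}$ be the trace from $\mathbb{F}_{q^m}$ to $\mathbb{F}_q$, and let $a\in\mathbb{F}_q$, $a\neq 0$. Let $f:\mathbb{F}_{q^m}\to\mathbb{F}_q$ be a quadratic form over $\mathbb{F}_q$ that is non-degenerate, i.e. $\{x\in\mathbb{F}_{q^m} : f(x+y)=f(y)\text{ for all }y\in\mathbb{F}_{q^m}\}=\{0\}$, and of Type II (elliptic), i.e. in suitable $\mathbb{F}_q$-linear coordinates $$f = x_1x_2+x_3x_4+\cdots+x_{m-3}x_{m-2}+\alpha x_{m-1}^2+x_{m-1}x_m+\alpha x_m^2$$ for some $\alpha\in\mathbb{F}_q\setminus\{x^2+x : x\in\mathbb{F}_q\}$. Let $D_f=\{d\in\mathbb{F}_{q^m} : f(d)=a\}$ and let $$C_{D_f}=\left\{\left(\mathrm{Tr}(xd)\right)_{d\in D_f} : x\in\mathbb{F}_{q^m}\right\},$$ a linear code over $\mathbb{F}_q$ of length $|D_f|$. For $1\le r\le \dim C_{D_f}$, let the $r$-th generalized Hamming weight $d_r=d_r(C_{D_f})$ be the minimum of $|\mathrm{supp}(H)|$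 over all $r$-dimensional $\mathbb{F}_q$-subspaces $H$ of $C_{D_f}$, where $\mathrm{supp}(H)$ is the set of coordinates at which some word of $H$ is nonzero. Then $\dim C_{D_f}=m$ and $$d_r=\begin{cases} q^{m-1}-q^{m-r-1}, & 1\le r\le \frac m2-1,\\ q^{m-1}+q^{\frac{m-2}{2}}-q^{m-r-1}-q^{m-r-2}, & \frac m2\le r<m-1,\\ q^{m-1}+q^{\frac{m-2}{2}}-1, & r=m-1,\\ q^{m-1}+q^{\frac{m-2}{2}}, & r=m. \end{cases}$$ -/

import Mathlib

/-- The support of a subspace `H` of `F ^ ι`: the coordinates at which some word of `H` is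
nonzero. -/
def codeSupport {F ι : Type*} [Field F] (H : Submodule F (ι → F)) : Set ι :=
  {i | ∃ c ∈ H, c i ≠ 0}

/-- The `r`-th generalized Hamming weight of a linear code `C`: the least size of the support
of an `r`-dimensional subspace of `C`. -/
noncomputable def genHammingWeight {F ι : Type*} [Field F] (C : Submodule F (ι → F)) (r : ℕ) : ℕ :=
  sInf {w | ∃ H : Submodule F (ι → F),
    H ≤ C ∧ Module.finrank F H = r ∧ (codeSupport H).ncard = w}

/-- The map `x ↦ (Tr (x d))_{d ∈ D}`, where `Tr` is the trace of `K` over `F`. -/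
noncomputable def traceEval (F : Type*) {K : Type*} [Field F] [Field K] [Algebra F K] (D : Set K) :
    K →ₗ[F] (D → F) :=
  LinearMap.pi fun d => Algebra.trace F K ∘ₗ LinearMap.mulRight F (d : K)

/-- The linear code over `F` with defining set `D`, `{(Tr (x d))_{d ∈ D} : x ∈ K}`; its
coordinates are indexed by the elements of `D`. -/
noncomputable def definingSetCode (F : Type*) {K : Type*} [Field F] [Field K] [Algebra F K]
    (D : Set K) : Submodule F (D → F) :=
  LinearMap.range (traceEval F D)

/-- With `t = 2 * s + 2 ≤ n` and coordinates numbered from 1, the quadratic form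
`x₁ x₂ + ⋯ + x_{t-3} x_{t-2} + α x_{t-1}² + x_{t-1} x_t + α x_t²` on `F ^ n`. -/
noncomputable def typeTwoForm {F : Type*} [Field F] (n s : ℕ) (h : 2 * s + 2 ≤ n) (α : F) :
    QuadraticForm F (Fin n → F) :=
  ∑ i : Fin s, QuadraticMap.proj ⟨2 * i, by omega⟩ ⟨2 * i + 1, by omega⟩
    + α • QuadraticMap.proj ⟨2 * s, by omega⟩ ⟨2 * s, by omega⟩
    + QuadraticMap.proj ⟨2 * s, by omega⟩ ⟨2 * s + 1, by omega⟩
    + α • QuadraticMap.proj ⟨2 * s + 1, by omega⟩ ⟨2 * s + 1, by omega⟩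

/-- `f` is equivalent, under a linear change of coordinates, to a form of Type II. -/
def IsTypeTwo {F V : Type*} [Field F] [AddCommGroup V] [Module F V]
    (f : QuadraticForm F V) : Prop :=
  ∃ (s : ℕ) (h : 2 * s + 2 ≤ Module.finrank F V) (α : F),
    (∀ x : F, x ^ 2 + x ≠ α) ∧
      QuadraticMap.Equivalent f (typeTwoForm (Module.finrank F V) s h α)

open Module

theorem QuadraticMap.natCard_fiber_eq {F V : Type*} [Field F] [Finite F] [CharP F 2]
    [AddCommGroup V] [Module F V] (Q : QuadraticForm F V) {a c : F} (ha : a ≠ 0) (hc : c ≠ 0) :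
    Nat.card {x // Q x = c} = Nat.card {x // Q x = a} := by
  have : Fintype F := Fintype.ofFinite F
  obtain ⟨s, hs⟩ := FiniteField.isSquare_of_char_two (ringChar.eq F 2) (a / c)
  have hs0 : s ≠ 0 := by
    rintro rfl
    exact (div_ne_zero ha hc) (by simpa using hs)
  refine Nat.card_congr ((DistribMulAction.toAddEquiv₀ V s hs0).toEquiv.subtypeEquiv fun x => ?_)
  change Q x = c ↔ Q (s • x) = a
  rw [QuadraticMap.map_smul, ← hs, smul_eq_mul, div_mul_eq_mul_div, div_eq_iff hc,
    mul_right_inj' ha]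

theorem QuadraticMap.card_mul_natCard_fiber {F V : Type*} [Field F] [Finite F] [CharP F 2]
    [AddCommGroup V] [Module F V] [Fintype V] (Q : QuadraticForm F V) {a : F} (ha : a ≠ 0)
    {ψ : AddChar F ℂ} (hψ : ψ ≠ 1) :
    (Nat.card F : ℂ) * Nat.card {x // Q x = a} = Nat.card V - ∑ x, ψ (Q x) := by
  classical
  have : Fintype F := Fintype.ofFinite F
  have h1 : ∑ x, (1 - ψ (Q x)) = ∑ c, (Nat.card {x // Q x = a} : ℂ) * (1 - ψ c) := by
    rw [← Finset.sum_fiberwise (s := Finset.univ) (g := fun x => Q x)]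
    refine Finset.sum_congr rfl fun c _ => ?_
    rw [Finset.sum_congr rfl (g := fun _ => 1 - ψ c)
      (fun x hx => by rw [(Finset.mem_filter.1 hx).2])]
    rcases eq_or_ne c 0 with rfl | hc
    · simp
    · rw [← Q.natCard_fiber_eq ha hc, Finset.sum_const, nsmul_eq_mul, Nat.card_eq_fintype_card,
        Fintype.card_subtype]
  rw [← Finset.mul_sum, Finset.sum_sub_distrib, Finset.sum_sub_distrib,
    AddChar.sum_eq_zero_of_ne_one hψ] at h1
  simp only [Finset.sum_const, Finset.card_univ, nsmul_eq_mul, mul_one, sub_zero] at h1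
  rw [Nat.card_eq_fintype_card (α := F), Nat.card_eq_fintype_card (α := V), h1, mul_comm]

theorem QuadraticMap.charSum_sq {F V : Type*} [Field F] [Finite F] [CharP F 2]
    [AddCommGroup V] [Module F V] [Fintype V] (Q : QuadraticForm F V)
    {ψ : AddChar F ℂ} (hψ : ψ ≠ 1) :
    (∑ x, ψ (Q x)) ^ 2 = Nat.card V * Nat.card Q.polarBilin.ker ∨ ∑ x, ψ (Q x) = 0 := by
  classical
  have hF : Fintype F := Fintype.ofFinite F
  have h2 : ∀ c : F, c + c = 0 := CharTwo.add_self_eq_zero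
  have key : (∑ x, ψ (Q x)) ^ 2 =
      Nat.card V * ∑ z : Q.polarBilin.ker, ψ (Q z) := by
    calc (∑ x, ψ (Q x)) ^ 2 = ∑ x, ∑ y, ψ (Q x) * ψ (Q y) := by rw [pow_two, Finset.sum_mul_sum]
      _ = ∑ x, ∑ z, ψ (Q z) * ψ (Q.polarBilin z x) := by
        refine Finset.sum_congr rfl fun x _ => ?_
        rw [← Equiv.sum_comp (Equiv.addRight x)]
        refine Finset.sum_congr rfl fun z _ => ?_
        rw [← AddChar.map_add_eq_mul, ← AddChar.map_add_eq_mul]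
        congr 1
        simp only [Equiv.coe_addRight, QuadraticMap.polarBilin_apply_apply, QuadraticMap.polar]
        linear_combination h2 (Q x)
      _ = ∑ z, ψ (Q z) * ∑ x, ψ (Q.polarBilin z x) := by
        rw [Finset.sum_comm]; simp_rw [Finset.mul_sum]
      _ = ∑ z, if z ∈ Q.polarBilin.ker then ψ (Q z) * Nat.card V else 0 := by
        refine Finset.sum_congr rfl fun z _ => ?_
        split_ifs with hz
        · rw [LinearMap.mem_ker] at hz
          simp [hz]
        · have h0 : ∑ x, (ψ.compAddMonoidHom (Q.polarBilin z).toAddMonoidHom) x = 0 := by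
            rw [AddChar.sum_eq_zero_iff_ne_zero]
            intro h
            apply hz
            rw [LinearMap.mem_ker]
            by_contra hz'
            obtain ⟨x, hx⟩ : ∃ x, Q.polarBilin z x ≠ 0 := by
              by_contra! h'
              exact hz' (LinearMap.ext h')
            obtain ⟨c, hc⟩ := AddChar.ne_one_iff.1 hψ
            apply hc
            have := DFunLike.congr_fun h ((c / Q.polarBilin z x) • x)
            simpa [hx, -QuadraticMap.polarBilin_apply_apply] using this
          simp only [AddChar.compAddMonoidHom_apply, LinearMap.toAddMonoidHom_coe] at h0
          rw [h0, mul_zero]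
      _ = _ := by
        rw [← Finset.sum_filter, ← Finset.sum_mul, mul_comm]
        congr 1
        exact (Finset.sum_subtype _ (by simp) _)
  let g : Q.polarBilin.ker →+ F :=
    { toFun := fun z => Q z
      map_zero' := by simp
      map_add' := fun x y => by
        have := LinearMap.congr_fun (LinearMap.mem_ker.1 x.2) y
        simp only [QuadraticMap.polarBilin_apply_apply, QuadraticMap.polar,
          LinearMap.zero_apply] at this
        simp only [Submodule.coe_add]
        linear_combination this }
  have h3 := AddChar.sum_eq_ite (ψ.compAddMonoidHom g)
  change ∑ z : Q.polarBilin.ker, ψ (Q z) = _ at h3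
  rw [key, h3]
  split_ifs with h
  · left; rw [Nat.card_eq_fintype_card (α := Q.polarBilin.ker)]
  · right
    rw [if_neg h] at h3
    rw [h3, mul_zero] at key
    exact pow_eq_zero_iff two_ne_zero |>.1 key

theorem AddChar.exists_ne_one_complex (F : Type*) [Field F] [Finite F] :
    ∃ ψ : AddChar F ℂ, ψ ≠ 1 := by
  obtain ⟨ψ, hψ⟩ := (AddChar.exists_apply_ne_zero (a := (1 : F))).2 one_ne_zero
  exact ⟨ψ, AddChar.ne_one_iff.2 ⟨1, hψ⟩⟩

theorem QuadraticMap.sq_card_mul_natCard_fiber_sub {F V : Type*} [Field F] [Finite F] [CharP F 2]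
    [AddCommGroup V] [Module F V] [Finite V] (Q : QuadraticForm F V) {a : F} (ha : a ≠ 0) :
    ((Nat.card F : ℤ) * Nat.card {x // Q x = a} - Nat.card V) ^ 2 =
        Nat.card V * Nat.card Q.polarBilin.ker ∨
      (Nat.card F : ℤ) * Nat.card {x // Q x = a} - Nat.card V = 0 := by
  have : Fintype V := Fintype.ofFinite V
  obtain ⟨ψ, hψ⟩ := AddChar.exists_ne_one_complex F
  have h := Q.card_mul_natCard_fiber ha hψ
  rcases Q.charSum_sq hψ with h' | h'
  · left
    have : ((Nat.card F : ℂ) * Nat.card {x // Q x = a} - Nat.card V) ^ 2 =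
        Nat.card V * Nat.card Q.polarBilin.ker := by rw [h, ← h']; ring
    exact_mod_cast this
  · right
    have : ((Nat.card F : ℂ) * Nat.card {x // Q x = a} - Nat.card V) = 0 := by rw [h, h']; ring
    exact_mod_cast this

theorem LinearMap.BilinForm.finrank_ker_add_two_le_of_isAlt {F V : Type*} [Field F] [AddCommGroup V]
    [Module F V] [FiniteDimensional F V] {B : LinearMap.BilinForm F V} (hB : B.IsAlt)
    (h : B ≠ 0) : finrank F B.ker + 2 ≤ finrank F V := by
  obtain ⟨u, v, huv⟩ : ∃ u v, B u v ≠ 0 := by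
    by_contra! h'
    exact h (LinearMap.ext₂ h')
  let φ : V →ₗ[F] F × F := (B u).prod (B v)
  have hsurj : Function.Surjective φ := by
    rintro ⟨a, b⟩
    refine ⟨(a / B u v) • v - (b / B u v) • u, ?_⟩
    have hvu : B v u = - B u v := by rw [← LinearMap.BilinForm.IsAlt.neg_eq hB u v]
    simp [φ, hB.self_eq_zero, hvu, huv]
  have h1 := φ.finrank_range_add_finrank_ker
  rw [LinearMap.range_eq_top.2 hsurj, finrank_top, finrank_prod, finrank_self] at h1
  have h2 : B.ker ≤ φ.ker := by
    intro x hx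
    have hx' : ∀ y, B y x = 0 := fun y => by
      rw [← LinearMap.BilinForm.IsAlt.neg_eq hB x y, LinearMap.mem_ker.1 hx]; simp
    simp [φ, hx']
  have := Submodule.finrank_mono h2
  omega

theorem QuadraticMap.isAlt_polarBilin_of_charTwo {F V : Type*} [Field F] [CharP F 2]
    [AddCommGroup V] [Module F V] (Q : QuadraticForm F V) : Q.polarBilin.IsAlt := fun x => by
  simp [CharTwo.two_eq_zero]

theorem QuadraticMap.finrank_ker_polarBilin_comp_subtype_add_le {F V : Type*} [Field F] [CharP F 2]
    [AddCommGroup V] [Module F V] [FiniteDimensional F V] (Q : QuadraticForm F V)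
    (hQ : Q.polarBilin.ker = ⊥) (U : Submodule F V) :
    finrank F (Q.comp U.subtype).polarBilin.ker + finrank F U ≤ finrank F V := by
  have hrefl : Q.polarBilin.IsRefl := Q.isAlt_polarBilin_of_charTwo.isRefl
  have h1 := LinearMap.BilinForm.finrank_add_finrank_orthogonal hrefl U
  have h2 : LinearMap.BilinForm.orthogonal Q.polarBilin ⊤ = ⊥ := by
    rw [LinearMap.BilinForm.orthogonal_top_eq_ker hrefl, hQ]
  rw [h2, inf_bot_eq, finrank_bot, add_zero] at h1
  have h3 : (Q.comp U.subtype).polarBilin.ker.map U.subtype ≤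
      LinearMap.BilinForm.orthogonal Q.polarBilin U := by
    rintro _ ⟨x, hx, rfl⟩ y hy
    have := LinearMap.congr_fun (LinearMap.mem_ker.1 hx) ⟨y, hy⟩
    apply hrefl
    simpa [QuadraticMap.polar] using this
  have h4 := Submodule.finrank_mono h3
  rw [Submodule.finrank_map_subtype_eq] at h4
  omega

theorem QuadraticMap.card_mul_natCard_fiber_le_of_polarBilin_eq_zero {F V : Type*} [Field F]
    [Finite F] [CharP F 2] [AddCommGroup V] [Module F V] [Finite V] (Q : QuadraticForm F V)
    {a : F} (ha : a ≠ 0) (hQ : Q.polarBilin = 0) :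
    Nat.card F * Nat.card {x // Q x = a} ≤ Nat.card V := by
  rcases isEmpty_or_nonempty {x // Q x = a} with h | ⟨u, hu⟩
  · simp
  have hadd : ∀ x y, Q (x + y) = Q x + Q y := fun x y => by
    have := LinearMap.congr_fun₂ hQ x y
    simp only [QuadraticMap.polarBilin_apply_apply, QuadraticMap.polar,
      LinearMap.zero_apply] at this
    linear_combination this
  rw [← Nat.card_prod]
  refine Nat.card_le_card_of_injective
    (fun y : F × {x // Q x = a} => (y.2 : V) + y.1 • u) ?_
  rintro ⟨c, x, hx⟩ ⟨d, y, hy⟩ h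
  have h1 := congrArg Q h
  simp only [hadd, hx, hy, QuadraticMap.map_smul, hu, smul_eq_mul, add_right_inj,
    mul_eq_mul_right_iff, ha, or_false] at h1
  have hcd : c = d := by
    rw [← pow_two, ← pow_two] at h1
    exact (CharTwo.sq_injective) h1
  subst hcd
  simpa using h

theorem QuadraticMap.natCard_fiber_comp_subtype_le {F V : Type*} [Field F] [Finite F] [CharP F 2]
    [AddCommGroup V] [Module F V] [Finite V] (Q : QuadraticForm F V) {a : F} (ha : a ≠ 0)
    (hQ : Q.polarBilin.ker = ⊥) {s k : ℕ} (hV : finrank F V = 2 * s + 2) (U : Submodule F V)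
    (hU : finrank F U = k + 1) :
    Nat.card {x // Q.comp U.subtype x = a} ≤ Nat.card F ^ k + Nat.card F ^ s := by
  have hq : 0 < Nat.card F := Nat.card_pos
  have h1 := Q.finrank_ker_polarBilin_comp_subtype_add_le hQ U
  have h2 : |(Nat.card F : ℤ) * Nat.card {x // Q.comp U.subtype x = a} - Nat.card U| ≤
      (Nat.card F : ℤ) ^ (s + 1) := by
    refine abs_le_of_sq_le_sq ?_ (by positivity)
    rcases (Q.comp U.subtype).sq_card_mul_natCard_fiber_sub ha with h | h
    · rw [h, Module.natCard_eq_pow_finrank (K := F) (V := U),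
        Module.natCard_eq_pow_finrank (K := F) (V := (Q.comp U.subtype).polarBilin.ker)]
      push_cast
      rw [← pow_add, ← pow_mul]
      exact pow_le_pow_right₀ (by exact_mod_cast hq) (by omega)
    · rw [h]; positivity
  rw [Module.natCard_eq_pow_finrank (K := F) (V := U), hU] at h2
  have h3 := (abs_le.1 h2).2
  refine Nat.le_of_mul_le_mul_left ?_ hq
  zify
  push_cast at h3
  linear_combination h3

theorem QuadraticMap.natCard_fiber_le {F V : Type*} [Field F] [Finite F] [CharP F 2]
    [AddCommGroup V] [Module F V] [Finite V] (Q : QuadraticForm F V) {a : F} (ha : a ≠ 0)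
    {k : ℕ} (hV : finrank F V = k + 2) :
    Nat.card {x // Q x = a} ≤ Nat.card F ^ (k + 1) + Nat.card F ^ k := by
  have hq : 0 < Nat.card F := Nat.card_pos
  have hcard := Module.natCard_eq_pow_finrank (K := F) (V := V)
  refine Nat.le_of_mul_le_mul_left ?_ hq
  by_cases hQ : Q.polarBilin = 0
  · have := Q.card_mul_natCard_fiber_le_of_polarBilin_eq_zero ha hQ
    rw [hcard, hV] at this
    refine this.trans ?_
    rw [mul_add, ← pow_succ']
    exact Nat.le_add_right _ _
  have h1 := LinearMap.BilinForm.finrank_ker_add_two_le_of_isAlt Q.isAlt_polarBilin_of_charTwo hQ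
  have h2 : |(Nat.card F : ℤ) * Nat.card {x // Q x = a} - Nat.card V| ≤
      (Nat.card F : ℤ) ^ (k + 1) := by
    refine abs_le_of_sq_le_sq ?_ (by positivity)
    rcases Q.sq_card_mul_natCard_fiber_sub ha with h | h
    · rw [h, hcard, Module.natCard_eq_pow_finrank (K := F) (V := Q.polarBilin.ker)]
      push_cast
      rw [← pow_add, ← pow_mul]
      exact pow_le_pow_right₀ (by exact_mod_cast hq) (by omega)
    · rw [h]; positivity
  rw [hcard, hV] at h2
  have h3 := (abs_le.1 h2).2
  zify
  push_cast at h3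
  linear_combination h3

theorem QuadraticMap.natCard_fiber_le_one {F V : Type*} [Field F] [Finite F] [CharP F 2]
    [AddCommGroup V] [Module F V] [Finite V] (Q : QuadraticForm F V) {a : F} (ha : a ≠ 0)
    (hV : finrank F V = 1) : Nat.card {x // Q x = a} ≤ 1 := by
  have hQ : Q.polarBilin = 0 := by
    by_contra hQ
    have := LinearMap.BilinForm.finrank_ker_add_two_le_of_isAlt Q.isAlt_polarBilin_of_charTwo hQ
    omega
  have := Q.card_mul_natCard_fiber_le_of_polarBilin_eq_zero ha hQ
  rw [Module.natCard_eq_pow_finrank (K := F) (V := V), hV, pow_one] at this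
  exact Nat.le_of_mul_le_mul_left (by simpa using this) (Nat.card_pos (α := F))

theorem QuadraticMap.natCard_eq_add_card_sub_one_mul {F V : Type*} [Field F] [Finite F]
    [CharP F 2] [AddCommGroup V] [Module F V] [Finite V] (Q : QuadraticForm F V) {a : F}
    (ha : a ≠ 0) :
    Nat.card V = Nat.card {x // Q x = 0} + (Nat.card F - 1) * Nat.card {x // Q x = a} := by
  classical
  have : Fintype F := Fintype.ofFinite F
  have : Fintype V := Fintype.ofFinite V
  have h := Finset.card_eq_sum_card_fiberwise (s := (Finset.univ : Finset V))
    (t := (Finset.univ : Finset F)) (f := Q) (by simp)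
  simp only [← Fintype.card_subtype, ← Nat.card_eq_fintype_card] at h
  rw [← Finset.add_sum_erase _ _ (Finset.mem_univ (0 : F)), Finset.sum_congr rfl
    (fun c hc => Q.natCard_fiber_eq ha (Finset.ne_of_mem_erase hc))] at h
  simpa [Finset.card_erase_of_mem] using h

/-- The binary form `α y² + y z + α z²`. -/
noncomputable def ellipticPlane {F : Type*} [Field F] (α : F) : QuadraticForm F (F × F) :=
  α • QuadraticMap.linMulLin (LinearMap.fst F F F) (LinearMap.fst F F F)
    + QuadraticMap.linMulLin (LinearMap.fst F F F) (LinearMap.snd F F F)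
    + α • QuadraticMap.linMulLin (LinearMap.snd F F F) (LinearMap.snd F F F)

theorem ellipticPlane_apply {F : Type*} [Field F] (α : F) (x : F × F) :
    ellipticPlane α x = α * (x.1 * x.1) + x.1 * x.2 + α * (x.2 * x.2) := by
  simp [ellipticPlane]

theorem ellipticPlane_eq_zero_iff {F : Type*} [Field F] [Finite F] [CharP F 2] {α : F}
    (hα : ∀ x : F, x ^ 2 + x ≠ α) {x : F × F} : ellipticPlane α x = 0 ↔ x = 0 := by
  refine ⟨fun h => ?_, by rintro rfl; simp⟩
  obtain ⟨y, z⟩ := x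
  rw [ellipticPlane_apply] at h
  have hα0 : α ≠ 0 := fun h => hα 0 (by simp [h])
  by_cases hz : z = 0
  · subst hz
    simpa [hα0] using h
  · exfalso
    have : Fintype F := Fintype.ofFinite F
    obtain ⟨β, hβ⟩ := FiniteField.isSquare_of_char_two (ringChar.eq F 2) (α * (y / z))
    apply hα β
    apply CharTwo.sq_injective
    have h0 : α * (y / z) ^ 2 + y / z + α = 0 := by
      field_simp
      simp only at h
      linear_combination h
    change (β ^ 2 + β) ^ 2 = α ^ 2
    have h2 : (2 : F) = 0 := CharTwo.two_eq_zero
    have e : (α * (y / z)) ^ 2 + α * (y / z) = α ^ 2 := by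
      linear_combination α * h0 - α ^ 2 * h2
    rw [← e, hβ]
    linear_combination β ^ 3 * h2

theorem sum_addChar_ellipticPlane {F : Type*} [Field F] [Fintype F] [CharP F 2] {α : F}
    (hα : ∀ x : F, x ^ 2 + x ≠ α) {ψ : AddChar F ℂ} (hψ : ψ ≠ 1) :
    ∑ x, ψ (ellipticPlane α x) = -(Nat.card F : ℂ) := by
  have h1 := (ellipticPlane α).card_mul_natCard_fiber one_ne_zero hψ
  have h2 := (ellipticPlane α).natCard_eq_add_card_sub_one_mul (a := 1) one_ne_zero
  have h0 : Nat.card {x // ellipticPlane α x = 0} = 1 := by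
    simp_rw [ellipticPlane_eq_zero_iff hα]
    simp
  have hq : 1 < Nat.card F := Finite.one_lt_card
  rw [h0, Nat.card_prod] at h2
  obtain ⟨r, hr⟩ : ∃ r, Nat.card F = r + 2 := ⟨Nat.card F - 2, by omega⟩
  have h3 : Nat.card {x // ellipticPlane α x = 1} = Nat.card F + 1 := by
    rw [hr] at h2 ⊢
    refine Nat.eq_of_mul_eq_mul_left (Nat.succ_pos r) ?_
    simp only [show r + 2 - 1 = r + 1 from rfl] at h2
    simp only [Nat.succ_eq_add_one]
    linarith
  rw [h3, Nat.card_prod] at h1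
  push_cast at h1
  linear_combination h1

theorem sum_addChar_hyperbolicPlane {F : Type*} [Field F] [Fintype F]
    {ψ : AddChar F ℂ} (hψ : ψ ≠ 1) : ∑ x : F × F, ψ (x.1 * x.2) = Nat.card F := by
  classical
  rw [Fintype.sum_prod_type]
  have h : ∀ b : F, ∑ x, ψ (b * x) = if b = 0 then (Fintype.card F : ℂ) else 0 := fun b => by
    simpa [mul_comm] using AddChar.sum_mulShift b (AddChar.IsPrimitive.of_ne_one hψ)
  simp [h]

theorem typeTwoForm_apply {F : Type*} [Field F] (n s : ℕ) (h : 2 * s + 2 ≤ n) (α : F)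
    (x : Fin n → F) :
    typeTwoForm n s h α x =
      ∑ i : Fin s, x ⟨2 * i, by omega⟩ * x ⟨2 * i + 1, by omega⟩
        + ellipticPlane α (x ⟨2 * s, by omega⟩, x ⟨2 * s + 1, by omega⟩) := by
  simp [typeTwoForm, ellipticPlane_apply, add_assoc]

theorem finrank_eq_of_isTypeTwo {F : Type*} [Field F] {n s : ℕ}
    (h : 2 * s + 2 ≤ n) {α : F} (hr : (typeTwoForm n s h α).radical = ⊥) : n = 2 * s + 2 := by
  by_contra hn
  have hlt : 2 * s + 2 < n := by omega
  have hmem : (Pi.single ⟨2 * s + 2, hlt⟩ 1 : Fin n → F) ∈ (typeTwoForm n s h α).radical := by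
    rw [QuadraticMap.mem_radical_iff']
    have h0 : ∀ j : ℕ, ∀ hj : j < 2 * s + 2,
        (Pi.single ⟨2 * s + 2, hlt⟩ 1 : Fin n → F) ⟨j, hj.trans hlt⟩ = 0 := fun j hj => by
      rw [Pi.single_eq_of_ne]
      simp only [ne_eq, Fin.mk.injEq]
      omega
    have h1 : ∀ y, typeTwoForm n s h α (Pi.single ⟨2 * s + 2, hlt⟩ 1 + y) =
        typeTwoForm n s h α y := fun y => by
      have e : ∀ j : ℕ, ∀ hj : j < 2 * s + 2,
          (Pi.single ⟨2 * s + 2, hlt⟩ 1 + y : Fin n → F) ⟨j, hj.trans hlt⟩ =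
            y ⟨j, hj.trans hlt⟩ := fun j hj => by rw [Pi.add_apply, h0 j hj, zero_add]
      rw [typeTwoForm_apply, typeTwoForm_apply, e (2 * s) (by omega), e (2 * s + 1) (by omega)]
      congr 1
      exact Finset.sum_congr rfl fun i _ => by
        rw [e (2 * i) (by omega), e (2 * i + 1) (by omega)]
    exact ⟨by simpa using h1 0, h1⟩
  rw [hr, Submodule.mem_bot] at hmem
  simpa using congrFun hmem ⟨2 * s + 2, hlt⟩

/-- Coordinates on `F ^ n` grouped into `s` pairs and a last pair. -/
def pairCoordinates (F : Type*) [Field F] (n s : ℕ) :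
    ((Fin s → F × F) × (F × F)) →ₗ[F] (Fin n → F) where
  toFun w j :=
    if hj : (j : ℕ) < 2 * s then
      if (j : ℕ) % 2 = 0 then (w.1 ⟨j / 2, by omega⟩).1 else (w.1 ⟨j / 2, by omega⟩).2
    else if (j : ℕ) = 2 * s then w.2.1 else if (j : ℕ) = 2 * s + 1 then w.2.2 else 0
  map_add' w w' := by
    ext j
    simp only [Pi.add_apply]
    split_ifs <;> simp
  map_smul' c w := by
    ext j
    simp only [Pi.smul_apply, RingHom.id_apply]
    split_ifs <;> simp

section

variable {F : Type*} [Field F] {n s : ℕ} (w : (Fin s → F × F) × (F × F))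

theorem pairCoordinates_fst (i : Fin s) (h : 2 * (i : ℕ) < n) :
    pairCoordinates F n s w ⟨2 * i, h⟩ = (w.1 i).1 := by
  simp [pairCoordinates]

theorem pairCoordinates_snd (i : Fin s) (h : 2 * (i : ℕ) + 1 < n) :
    pairCoordinates F n s w ⟨2 * i + 1, h⟩ = (w.1 i).2 := by
  have h1 : 2 * (i : ℕ) + 1 < 2 * s := by omega
  have h2 : (2 * (i : ℕ) + 1) / 2 = i := by omega
  simp [pairCoordinates, h1, h2]

theorem pairCoordinates_last_fst (h : 2 * s < n) :
    pairCoordinates F n s w ⟨2 * s, h⟩ = w.2.1 := by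
  simp [pairCoordinates]

theorem pairCoordinates_last_snd (h : 2 * s + 1 < n) :
    pairCoordinates F n s w ⟨2 * s + 1, h⟩ = w.2.2 := by
  simp [pairCoordinates]

theorem typeTwoForm_pairCoordinates (h : 2 * s + 2 ≤ n) (α : F) :
    typeTwoForm n s h α (pairCoordinates F n s w) =
      ∑ i : Fin s, (w.1 i).1 * (w.1 i).2 + ellipticPlane α w.2 := by
  rw [typeTwoForm_apply]
  simp only [pairCoordinates_fst, pairCoordinates_snd, pairCoordinates_last_fst,
    pairCoordinates_last_snd]

theorem pairCoordinates_injective (h : 2 * s + 2 ≤ n) :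
    Function.Injective (pairCoordinates F n s) := by
  intro w w' e
  refine Prod.ext (funext fun i => Prod.ext ?_ ?_) (Prod.ext ?_ ?_)
  · have h1 := congrFun e ⟨2 * i, by omega⟩
    rwa [pairCoordinates_fst, pairCoordinates_fst] at h1
  · have h1 := congrFun e ⟨2 * i + 1, by omega⟩
    rwa [pairCoordinates_snd, pairCoordinates_snd] at h1
  · have h1 := congrFun e ⟨2 * s, by omega⟩
    rwa [pairCoordinates_last_fst, pairCoordinates_last_fst] at h1
  · have h1 := congrFun e ⟨2 * s + 1, by omega⟩
    rwa [pairCoordinates_last_snd, pairCoordinates_last_snd] at h1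

end

/-- The subspace of `(F × F) ^ s` on which the second entries vanish from index `t` on and
the first entries from index `p` on. -/
def coordinateFlag (F : Type*) [Field F] (s t p : ℕ) : Submodule F (Fin s → F × F) where
  carrier := {w | ∀ i : Fin s, (t ≤ i → (w i).2 = 0) ∧ (p ≤ i → (w i).1 = 0)}
  zero_mem' := by simp
  add_mem' := fun {x y} hx hy i => by
    constructor <;> intro hi
    · simp [(hx i).1 hi, (hy i).1 hi]
    · simp [(hx i).2 hi, (hy i).2 hi]
  smul_mem' c x hx i := by
    constructor <;> intro hi
    · simp [(hx i).1 hi]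
    · simp [(hx i).2 hi]

theorem Fin.prod_ite_lt_pow {M : Type*} [CommMonoid M] {s t p : ℕ} (htp : t ≤ p) (hps : p ≤ s)
    (x y : M) :
    ∏ i : Fin s, (if (i : ℕ) < t then x * y else if (i : ℕ) < p then x else 1) =
      x ^ p * y ^ t := by
  have e : ∀ i : Fin s, (if (i : ℕ) < t then x * y else if (i : ℕ) < p then x else 1) =
      (if (i : ℕ) < p then x else 1) * (if (i : ℕ) < t then y else 1) := fun i => by
    split_ifs <;> first | omega | simp
  have hpow : ∀ r, r ≤ s → ∀ z : M, ∏ i : Fin s, (if (i : ℕ) < r then z else 1) = z ^ r := by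
    intro r hr z
    rw [Fin.prod_univ_eq_prod_range (fun i => if i < r then z else 1) s, Finset.prod_ite]
    have : (Finset.range s).filter (· < r) = Finset.range r := by
      ext; simp; omega
    simp [this]
  simp_rw [e]
  rw [Finset.prod_mul_distrib, hpow p hps, hpow t (htp.trans hps)]

section

variable {F : Type*} [Field F] [Fintype F] {s t p : ℕ} [Fintype (coordinateFlag F s t p)]

theorem sum_coordinateFlag [DecidableEq F] (g : F × F → ℂ) :
    ∑ w : coordinateFlag F s t p, ∏ i, g (w.1 i) =
      ∏ i : Fin s, ∑ x : F × F with (t ≤ i → x.2 = 0) ∧ (p ≤ i → x.1 = 0), g x := by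
  rw [Finset.prod_univ_sum]
  refine (Finset.sum_subtype _ (fun w => ?_) (fun w : Fin s → F × F => ∏ i, g (w i))).symm
  simp [Fintype.mem_piFinset, coordinateFlag]

theorem sum_coordinateFlag_eq (htp : t ≤ p) (hps : p ≤ s) (g : F × F → ℂ) (A : ℂ)
    (h1 : ∑ x, g x = Nat.card F * A) (h2 : ∑ x, g (x, 0) = Nat.card F) (h3 : g 0 = 1) :
    ∑ w : coordinateFlag F s t p, ∏ i, g (w.1 i) = Nat.card F ^ p * A ^ t := by
  classical
  rw [sum_coordinateFlag, ← Fin.prod_ite_lt_pow htp hps]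
  refine Finset.prod_congr rfl fun i _ => ?_
  rw [Finset.sum_filter, Fintype.sum_prod_type]
  rw [Fintype.sum_prod_type] at h1
  split_ifs with hi hi'
  · simpa [hi.not_ge, (hi.trans_le htp).not_ge] using h1
  · simpa [hi'.not_ge, not_lt.1 hi] using h2
  · simp only [not_lt.1 hi, not_lt.1 hi', true_imp_iff]
    simpa [ite_and, ← Prod.zero_eq_mk] using h3

theorem natCard_coordinateFlag (htp : t ≤ p) (hps : p ≤ s) :
    Nat.card (coordinateFlag F s t p) = Nat.card F ^ (p + t) := by
  have h := sum_coordinateFlag_eq (F := F) htp hps (fun _ => 1) (Nat.card F) (by simp) (by simp) rfl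
  simp only [Finset.prod_const_one, Finset.sum_const, Finset.card_univ, nsmul_eq_mul, mul_one,
    ← pow_add] at h
  rw [Nat.card_eq_fintype_card]
  exact_mod_cast h

theorem sum_addChar_coordinateFlag (htp : t ≤ p) (hps : p ≤ s) {ψ : AddChar F ℂ} (hψ : ψ ≠ 1) :
    ∑ w : coordinateFlag F s t p, ψ (∑ i, (w.1 i).1 * (w.1 i).2) = Nat.card F ^ p := by
  have h := sum_coordinateFlag_eq (F := F) htp hps (fun x => ψ (x.1 * x.2)) 1
    (by rw [sum_addChar_hyperbolicPlane hψ, mul_one]) (by simp) (by simp)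
  rw [one_pow, mul_one] at h
  rw [← h]
  exact Finset.sum_congr rfl fun w _ => map_prod ψ.toMonoidHom
    (fun i => Multiplicative.ofAdd ((w.1 i).1 * (w.1 i).2)) Finset.univ

end

theorem exists_submodule_card_mul_natCard_fiber {F V : Type*} [Field F] [Finite F] [CharP F 2]
    [AddCommGroup V] [Module F V] [Finite V] {f : QuadraticForm F V} {n s : ℕ}
    {h : 2 * s + 2 ≤ n} {α : F} (hα : ∀ x : F, x ^ 2 + x ≠ α)
    (e : f.IsometryEquiv (typeTwoForm n s h α)) {a : F} (ha : a ≠ 0) {t p : ℕ} (htp : t ≤ p)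
    (hps : p ≤ s) :
    ∃ U : Submodule F V, finrank F U = p + t + 2 ∧
      Nat.card {x // f.comp U.subtype x = a} = Nat.card F ^ (p + t + 1) + Nat.card F ^ p := by
  classical
  have : Fintype F := Fintype.ofFinite F
  obtain ⟨ψ, hψ⟩ := AddChar.exists_ne_one_complex F
  have : Fintype (coordinateFlag F s t p) := Fintype.ofFinite _
  let j : (coordinateFlag F s t p × (F × F)) →ₗ[F] V :=
    e.symm.toLinearEquiv.toLinearMap ∘ₗ pairCoordinates F n s ∘ₗ
      (coordinateFlag F s t p).subtype.prodMap LinearMap.id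
  have hj : Function.Injective j :=
    e.symm.toLinearEquiv.injective.comp ((pairCoordinates_injective h).comp
      (Subtype.val_injective.prodMap Function.injective_id))
  have hfj : ∀ w, f (j w) = ∑ i : Fin s, (w.1.1 i).1 * (w.1.1 i).2 + ellipticPlane α w.2 :=
    fun w => (e.symm.map_app _).trans (typeTwoForm_pairCoordinates (w.1.1, w.2) h α)
  let E := LinearEquiv.ofInjective j hj
  have : Fintype j.range := Fintype.ofFinite _
  have hcard : Nat.card j.range = Nat.card F ^ (p + t + 2) := by
    rw [← Nat.card_congr E.toEquiv, Nat.card_prod, natCard_coordinateFlag htp hps, Nat.card_prod,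
      pow_add _ _ 2, pow_two]
  have hrank : finrank F j.range = p + t + 2 := by
    rw [Module.natCard_eq_pow_finrank (K := F)] at hcard
    exact Nat.pow_right_injective Finite.one_lt_card hcard
  have hsum : ∑ x : j.range, ψ (f.comp j.range.subtype x) = -(Nat.card F : ℂ) ^ (p + 1) := by
    rw [← E.toEquiv.sum_comp, Fintype.sum_prod_type]
    calc _ = ∑ w : coordinateFlag F s t p, ∑ x, ψ (∑ i, (w.1 i).1 * (w.1 i).2) *
          ψ (ellipticPlane α x) := by
          refine Finset.sum_congr rfl fun w _ => Finset.sum_congr rfl fun x _ => ?_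
          rw [← AddChar.map_add_eq_mul, ← hfj (w, x)]
          rfl
      _ = _ := by
          rw [← Finset.sum_mul_sum, sum_addChar_coordinateFlag htp hps hψ,
            sum_addChar_ellipticPlane hα hψ]
          ring
  refine ⟨j.range, hrank, ?_⟩
  have h1 := (f.comp j.range.subtype).card_mul_natCard_fiber ha hψ
  rw [hsum, hcard] at h1
  have hq : (Nat.card F : ℂ) ≠ 0 := by exact_mod_cast Nat.card_pos.ne'
  have : (Nat.card {x // f.comp j.range.subtype x = a} : ℂ) =
      Nat.card F ^ (p + t + 1) + Nat.card F ^ p := by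
    apply mul_left_cancel₀ hq
    rw [h1]
    push_cast
    ring
  exact_mod_cast this

section

variable {F K : Type*} [Field F] [Field K] [Algebra F K]

theorem traceEval_apply (D : Set K) (x : K) (d : D) :
    traceEval F D x d = Algebra.trace F K (x * d) := rfl

variable [Finite K]

theorem ncard_codeSupport_map_traceEval_add (D : Set K) (W : Submodule F K) :
    (codeSupport (W.map (traceEval F D))).ncard +
      (D ∩ (Algebra.traceForm F K).orthogonal W : Set K).ncard = D.ncard := by
  have h : Subtype.val '' codeSupport (W.map (traceEval F D)) =
      D \ ((Algebra.traceForm F K).orthogonal W : Set K) := by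
    ext d
    simp [codeSupport, traceEval_apply, LinearMap.BilinForm.mem_orthogonal_iff,
      Algebra.traceForm_apply, and_comm]
  rw [← Set.ncard_image_of_injective _ Subtype.val_injective, h, add_comm]
  exact Set.ncard_inter_add_ncard_sdiff_eq_ncard D _

variable [Finite F]

theorem finrank_traceForm_orthogonal (W : Submodule F K) :
    finrank F ((Algebra.traceForm F K).orthogonal W) = finrank F K - finrank F W :=
  LinearMap.BilinForm.finrank_orthogonal (traceForm_nondegenerate F K) W

theorem genHammingWeight_definingSetCode_add {D : Set K}
    (hD : Function.Injective (traceEval F D)) {r M : ℕ} (hr : r ≤ finrank F K)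
    (hle : ∀ U : Submodule F K, finrank F U = finrank F K - r → (D ∩ U : Set K).ncard ≤ M)
    (hex : ∃ U : Submodule F K, finrank F U = finrank F K - r ∧ (D ∩ U : Set K).ncard = M) :
    genHammingWeight (definingSetCode F D) r + M = D.ncard := by
  have hmem : D.ncard - M ∈ {w | ∃ H : Submodule F (D → F), H ≤ definingSetCode F D ∧
      finrank F H = r ∧ (codeSupport H).ncard = w} := by
    obtain ⟨U, hU, hUM⟩ := hex
    refine ⟨((Algebra.traceForm F K).orthogonal U).map (traceEval F D), LinearMap.map_le_range,
      ?_, ?_⟩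
    · rw [← (Submodule.equivMapOfInjective _ hD _).finrank_eq, finrank_traceForm_orthogonal, hU]
      omega
    · have h := ncard_codeSupport_map_traceEval_add D ((Algebra.traceForm F K).orthogonal U)
      rw [LinearMap.BilinForm.orthogonal_orthogonal (traceForm_nondegenerate F K)
        (Algebra.traceForm_isSymm F).isRefl, hUM] at h
      omega
  have hMD : M ≤ D.ncard := by
    obtain ⟨U, -, rfl⟩ := hex
    exact Set.ncard_le_ncard Set.inter_subset_left (Set.toFinite D)
  refine le_antisymm ?_ ?_
  · have := Nat.sInf_le hmem
    unfold genHammingWeight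
    omega
  · obtain ⟨H, hH, hHr, hHw⟩ := Nat.sInf_mem ⟨_, hmem⟩
    unfold genHammingWeight
    rw [← hHw]
    have hmap : (H.comap (traceEval F D)).map (traceEval F D) = H :=
      Submodule.map_comap_eq_of_le hH
    have h := ncard_codeSupport_map_traceEval_add D (H.comap (traceEval F D))
    have hr' : finrank F (H.comap (traceEval F D)) = r := by
      rw [(Submodule.equivMapOfInjective _ hD _).finrank_eq, hmap, hHr]
    have := hle _ (by rw [finrank_traceForm_orthogonal, hr'])
    rw [hmap] at h
    omega

theorem traceEval_injective_of_ncard_inter_lt {D : Set K}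
    (h : ∀ U : Submodule F K, finrank F U = finrank F K - 1 → (D ∩ U : Set K).ncard < D.ncard) :
    Function.Injective (traceEval F D) := by
  rw [← LinearMap.ker_eq_bot, LinearMap.ker_eq_bot']
  intro x hx
  by_contra hx0
  have h1 := h ((Algebra.traceForm F K).orthogonal (Submodule.span F {x}))
    (by rw [finrank_traceForm_orthogonal, finrank_span_singleton hx0])
  have h2 : D ⊆ (Algebra.traceForm F K).orthogonal (Submodule.span F {x}) := by
    intro d hd y hy
    obtain ⟨c, rfl⟩ := Submodule.mem_span_singleton.1 hy
    have := congrFun hx ⟨d, hd⟩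
    rw [traceEval_apply] at this
    simp [Algebra.traceForm_apply] at this ⊢
    simp [this]
  rw [Set.inter_eq_left.2 h2] at h1
  exact h1.ne rfl

end

theorem ncard_inter_eq_natCard_fiber {F V : Type*} [Field F] [AddCommGroup V] [Module F V]
    (f : QuadraticForm F V) (a : F) (U : Submodule F V) :
    ({x | f x = a} ∩ U : Set V).ncard = Nat.card {x // f.comp U.subtype x = a} := by
  rw [← Nat.card_coe_set_eq]
  refine Nat.card_congr ⟨fun x => ⟨⟨x, x.2.2⟩, x.2.1⟩, fun x => ⟨x.1, x.2, x.1.2⟩, ?_, ?_⟩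
  · intro x; rfl
  · intro x; rfl

theorem polarBilin_ker_eq_bot_of_natCard_fiber {F V : Type*} [Field F] [Finite F] [CharP F 2]
    [AddCommGroup V] [Module F V] [Finite V] (f : QuadraticForm F V) {a : F} (ha : a ≠ 0) {s : ℕ}
    (hV : finrank F V = 2 * s + 2)
    (hN : Nat.card {x // f x = a} = Nat.card F ^ (2 * s + 1) + Nat.card F ^ s) :
    f.polarBilin.ker = ⊥ := by
  have hq : (0 : ℤ) < Nat.card F := by exact_mod_cast Nat.card_pos (α := F)
  have h1 : (Nat.card F : ℤ) * Nat.card {x // f x = a} - Nat.card V = Nat.card F ^ (s + 1) := by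
    rw [hN, Module.natCard_eq_pow_finrank (K := F) (V := V), hV]
    push_cast
    ring
  have h2 := f.sq_card_mul_natCard_fiber_sub ha
  rw [h1, Module.natCard_eq_pow_finrank (K := F) (V := V), hV] at h2
  rcases h2 with h | h
  · have hpow : (0 : ℤ) < Nat.card F ^ (2 * s + 2) := pow_pos hq _
    have h3 : (Nat.card f.polarBilin.ker : ℤ) = 1 := by
      refine mul_left_cancel₀ hpow.ne' ?_
      push_cast at h
      rw [← h]
      ring
    have h4 : Subsingleton f.polarBilin.ker :=
      (Nat.card_eq_one_iff_unique.1 (by exact_mod_cast h3)).1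
    exact Submodule.subsingleton_iff_eq_bot.1 h4
  · exact absurd h (pow_pos hq _).ne'

theorem theorem2 {F K : Type*} [Field F] [Finite F] [CharP F 2] [Field K] [Finite K] [Algebra F K]
    (q m : ℕ) (hq : Nat.card F = q) (hm : Module.finrank F K = m) (hm_even : Even m)
    (f : QuadraticForm F K) (hf : f.radical = ⊥) (hf2 : IsTypeTwo f)
    (a : F) (ha : a ≠ 0) :
    Module.finrank F (definingSetCode F {x : K | f x = a}) = m ∧
    (∀ r : ℕ, 1 ≤ r → r ≤ m / 2 - 1 →
      (genHammingWeight (definingSetCode F {x : K | f x = a}) r : ℤ) =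
        (q : ℤ) ^ (m - 1) - (q : ℤ) ^ (m - r - 1)) ∧
    (∀ r : ℕ, m / 2 ≤ r → r < m - 1 →
      (genHammingWeight (definingSetCode F {x : K | f x = a}) r : ℤ) =
        (q : ℤ) ^ (m - 1) + (q : ℤ) ^ ((m - 2) / 2) - (q : ℤ) ^ (m - r - 1)
          - (q : ℤ) ^ (m - r - 2)) ∧
    (genHammingWeight (definingSetCode F {x : K | f x = a}) (m - 1) : ℤ) =
      (q : ℤ) ^ (m - 1) + (q : ℤ) ^ ((m - 2) / 2) - 1 ∧
    (genHammingWeight (definingSetCode F {x : K | f x = a}) m : ℤ) =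
      (q : ℤ) ^ (m - 1) + (q : ℤ) ^ ((m - 2) / 2) := by
  obtain ⟨s, h, α, hα, ⟨e⟩⟩ := hf2
  have hV : finrank F K = 2 * s + 2 :=
    finrank_eq_of_isTypeTwo h (by rw [← e.map_radical, hf, Submodule.map_bot])
  obtain rfl : m = 2 * s + 2 := hm.symm.trans hV
  set D : Set K := {x : K | f x = a} with hDdef
  have hq1 : 1 < q := hq ▸ Finite.one_lt_card
  have hex : ∀ t p, t ≤ p → p ≤ s → ∃ U : Submodule F K, finrank F U = p + t + 2 ∧
      (D ∩ U : Set K).ncard = q ^ (p + t + 1) + q ^ p := fun t p htp hps => by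
    simpa only [hDdef, ncard_inter_eq_natCard_fiber, hq] using
      exists_submodule_card_mul_natCard_fiber hα e ha htp hps
  have hDcard : D.ncard = q ^ (2 * s + 1) + q ^ s := by
    obtain ⟨U, hU, hUN⟩ := hex s s le_rfl le_rfl
    have : U = ⊤ := Submodule.eq_top_of_finrank_eq (by rw [hU, hV]; ring)
    rw [this, Submodule.top_coe, Set.inter_univ] at hUN
    rw [hUN, two_mul]
  have hker : f.polarBilin.ker = ⊥ :=
    polarBilin_ker_eq_bot_of_natCard_fiber f ha hV (by rw [hq, ← hDcard]; rfl)
  have hle : ∀ k (U : Submodule F K), finrank F U = k + 1 →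
      (D ∩ U : Set K).ncard ≤ q ^ k + q ^ s := fun k U hU => by
    rw [hDdef, ncard_inter_eq_natCard_fiber, ← hq]
    exact f.natCard_fiber_comp_subtype_le ha hker hV U hU
  have hinj : Function.Injective (traceEval F D) := by
    refine traceEval_injective_of_ncard_inter_lt fun U hU => ?_
    refine (hle (2 * s) U (by omega)).trans_lt ?_
    rw [hDcard]
    exact Nat.add_lt_add_right (Nat.pow_lt_pow_right hq1 (by omega)) _
  refine ⟨(LinearMap.finrank_range_of_inj hinj).trans hV, fun r hr1 hr2 => ?_,
    fun r hr1 hr2 => ?_, ?_, ?_⟩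
  · obtain ⟨U, hU, hUN⟩ := hex (s - r) s (by omega) le_rfl
    have hd := genHammingWeight_definingSetCode_add (r := r) (M := q ^ (2 * s + 1 - r) + q ^ s)
      hinj (by omega) (fun U hU => hle _ U (by omega))
      ⟨U, by omega, by rw [hUN]; congr 2; omega⟩
    rw [hDcard] at hd
    rw [show 2 * s + 2 - 1 = 2 * s + 1 by omega, show 2 * s + 2 - r - 1 = 2 * s + 1 - r by omega]
    zify at hd
    linear_combination hd
  · obtain ⟨U, hU, hUN⟩ := hex 0 (2 * s - r) (by omega) (by omega)
    have hd := genHammingWeight_definingSetCode_add (r := r)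
      (M := q ^ (2 * s - r + 1) + q ^ (2 * s - r)) hinj (by omega)
      (fun U hU => by
        rw [hDdef, ncard_inter_eq_natCard_fiber, ← hq]
        exact (f.comp U.subtype).natCard_fiber_le ha (by omega))
      ⟨U, by omega, by rw [hUN, add_zero]⟩
    rw [hDcard] at hd
    rw [show 2 * s + 2 - 1 = 2 * s + 1 by omega,
      show 2 * s + 2 - r - 1 = 2 * s - r + 1 by omega,
      show 2 * s + 2 - r - 2 = 2 * s - r by omega, show (2 * s + 2 - 2) / 2 = s by omega]
    zify at hd
    linear_combination hd
  · have hle1 : ∀ U : Submodule F K, finrank F U = 1 → (D ∩ U : Set K).ncard ≤ 1 := fun U hU => by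
      rw [hDdef, ncard_inter_eq_natCard_fiber]
      exact (f.comp U.subtype).natCard_fiber_le_one ha hU
    obtain ⟨x, hx⟩ : D.Nonempty := by
      rw [← Set.ncard_pos (Set.toFinite D), hDcard]
      positivity
    have hx0 : x ≠ 0 := by
      rintro rfl
      exact ha (by simpa [hDdef] using hx.symm)
    have hd := genHammingWeight_definingSetCode_add (r := 2 * s + 1) (M := 1) hinj (by omega)
      (fun U hU => hle1 U (by omega))
      ⟨Submodule.span F {x}, by rw [finrank_span_singleton hx0]; omega,
        le_antisymm (hle1 _ (finrank_span_singleton hx0)) ((Set.ncard_pos (Set.toFinite _)).2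
          ⟨x, hx, Submodule.mem_span_singleton_self x⟩)⟩
    rw [hDcard] at hd
    rw [show 2 * s + 2 - 1 = 2 * s + 1 by omega, show (2 * s + 2 - 2) / 2 = s by omega]
    zify at hd
    linear_combination hd
  · have hbot : (D ∩ (⊥ : Submodule F K) : Set K).ncard = 0 := by
      rw [Set.ncard_eq_zero (Set.toFinite _)]
      ext x
      simp only [hDdef, Submodule.bot_coe, Set.mem_inter_iff, Set.mem_ofPred_eq,
        Set.mem_singleton_iff, Set.mem_empty_iff_false, iff_false, not_and]
      rintro hx rfl
      exact ha (by simpa using hx.symm)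
    have hd := genHammingWeight_definingSetCode_add (r := 2 * s + 2) (M := 0) hinj (by omega)
      (fun U hU => by
        rw [Submodule.finrank_eq_zero.1 (hU.trans (by omega)), hbot])
      ⟨⊥, by rw [finrank_bot]; omega, hbot⟩
    rw [hDcard] at hd
    rw [show 2 * s + 2 - 1 = 2 * s + 1 by omega, show (2 * s + 2 - 2) / 2 = s by omega]
    zify at hd
    linear_combination hd
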